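/- Let $\mathbf{k}$ be a commutative $\mathbb{Q}$-algebra, let $Y=\{y_n\}_{n\ge 1}$ be an alphabet, $Y^*$ the free monoid of words over $Y$, $Y^+$ the set of nonempty words, and $\mathbf{k}\langle Y\rangle$ the free associative algebra on $Y$ (with concatenation). Write $\langle P\mid w\rangle$ for the coefficient of the word $w$ in $P\in\mathbf{k}\langle Y\rangle$. Let $\ast$ be the stuffle (quasi-shuffle) product on $\mathbf{k}\langle Y\rangle$, i.e. the bilinear product with $w\ast 1=1\ast w=w$ and $$y_iu\ast y_jv=y_j(y_iu\ast v)+y_i(u\ast y_jv)+y_{i+j}(u\ast v)\qquad(i,j\ge1,\ u,v\in Y^*).$$ Let $\Delta:\mathbf{k}\langle Y\rangle\to\mathbf{k}\langle Y\rangle\otimes\mathbf{k}\langle Y\rangle$ be the algebra morphism (for concatenation) with $$\Delta(y_n)=y_n\otimes 1+1\otimes y_n+\sum_{i=1}^{n-1}y_i\otimes y_{n-i}\qquad(n\ge1),$$ which is the coproduct of the stuffle Hopf algebra $\mathcal{H}$ on $\mathbf{k}\langle Y\rangle$, and let $\mathrm{Prim}(\mathcal{H})=\{P\in\mathbf{k}\langle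 Y\rangle:\Delta(P)=P\otimes1+1\otimes P\}$, a Lie algebra for the commutator bracket. For a word $w\in Y^*$ put $$\pi_1(w)=w+\sum_{r\ge2}\frac{(-1)^{r-1}}{r}\sum_{u_1,\dots,u_r\in Y^+}\langle u_1\ast\cdots\ast u_r\mid w\rangle\,u_1\cdots u_r$$ (a finite sum). Finally, let $\mathcal{Y}(t)=1+\sum_{n\ge1}y_nt^n\in\mathbf{k}\langle Y\rangle[\![t]\!]$, where $t$ commutes with $Y$, and let $\log\mathcal{Y}(t)=\sum_{m\ge1}\frac{(-1)^{m-1}}{m}(\mathcal{Y}(t)-1)^m$. Then: 1. for every $n\ge1$, the coefficient of $t^n$ in $\log\mathcal{Y}(t)$ is $\pi_1(y_n)$; 2. the Lie subalgebra over $\mathbf{k}$ of $\mathbf{k}\langle Y\rangle$ generated by the coefficients of $t^n$, $n\ge1$, in $\log\mathcal{Y}(t)$ is equal to $\mathrm{Prim}(\mathcal{H})$. -/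

import Mathlib

open scoped TensorProduct

attribute [local instance] LieRing.ofAssociativeRing

noncomputable section

/-- The words `Y*` over the alphabet `Y = {y₁, y₂, …}`; the letter `y_n` is `FreeMonoid.of n`. -/
abbrev YWord : Type := FreeMonoid ℕ+

/-- The noncommutative polynomials `k⟨Y⟩`, with the concatenation product.
The pairing `⟨P | w⟩` of a polynomial with a word is the coefficient `P.coeff w`. -/
abbrev NCPoly (k : Type*) [CommRing k] : Type _ := MonoidAlgebra k YWord

namespace NCPoly

variable (k : Type*) [CommRing k]

/-- A word, seen as a polynomial. -/
def word (w : YWord) : NCPoly k := MonoidAlgebra.of k YWord w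

/-- The letter `y_n`, seen as a polynomial. -/
def y (n : ℕ+) : NCPoly k := word k (FreeMonoid.of n)

/-- The stuffle (quasi-shuffle) product of two words, given as lists of indices. -/
def stuffleWord : List ℕ+ → List ℕ+ → NCPoly k
  | [], v => word k (FreeMonoid.ofList v)
  | u, [] => word k (FreeMonoid.ofList u)
  | i :: u, j :: v =>
      y k j * stuffleWord (i :: u) v + y k i * stuffleWord u (j :: v)
        + y k (i + j) * stuffleWord u v
termination_by u v => u.length + v.length

variable {k} in
/-- The stuffle product of polynomials: the bilinear extension of the product of words. -/
def stuffle (P Q : NCPoly k) : NCPoly k :=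
  P.coeff.sum fun u a => Q.coeff.sum fun v b =>
    (a * b) • stuffleWord k (FreeMonoid.toList u) (FreeMonoid.toList v)

/-- The iterated stuffle product of a list of words. -/
def stuffleList (us : List YWord) : NCPoly k :=
  us.foldr (fun u P => stuffle (word k u) P) 1

/-- `π₁(w) = w + ∑_{r ≥ 2} (-1)^(r-1)/r ∑_{u₁, …, u_r ∈ Y⁺} ⟨w | u₁ ⧢ … ⧢ u_r⟩ u₁ … u_r`,
where `⧢` is the stuffle product and `Y⁺` is the set of nonempty words. The sum runs over the
lists `[u₁, …, u_r]`, and only finitely many of its terms are nonzero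
(see `finite_support_pi1`). -/
def pi1 [Algebra ℚ k] (w : YWord) : NCPoly k :=
  word k w + ∑ᶠ us ∈ {us : List YWord | 2 ≤ us.length ∧ ∀ u ∈ us, u ≠ 1},
    (algebraMap ℚ k ((-1) ^ (us.length - 1) / (us.length : ℚ)) * (stuffleList k us).coeff w) •
      word k us.prod

/-- The coproduct `Δ` of the stuffle bialgebra on the letters,
`Δ y_n = y_n ⊗ 1 + 1 ⊗ y_n + ∑_{i=1}^{n-1} y_i ⊗ y_{n-i}`
(the subtraction of positive integers is exact here, as `i < n`). -/
def coproductLetter (n : ℕ+) : NCPoly k ⊗[k] NCPoly k :=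
  y k n ⊗ₜ[k] 1 + 1 ⊗ₜ[k] y k n + ∑ i ∈ Finset.Iio n, y k i ⊗ₜ[k] y k (n - i)

/-- The coproduct of the stuffle bialgebra, extended from the letters as a morphism for the
concatenation. -/
def coproduct : NCPoly k →ₐ[k] NCPoly k ⊗[k] NCPoly k :=
  MonoidAlgebra.lift k (NCPoly k ⊗[k] NCPoly k) YWord (FreeMonoid.lift (coproductLetter k))

/-- The Lie algebra of primitive elements of the stuffle Hopf algebra, for the commutator bracket
of the concatenation product. -/
def prim : LieSubalgebra k (NCPoly k) where
  carrier := {P | coproduct k P = P ⊗ₜ[k] 1 + 1 ⊗ₜ[k] P}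
  add_mem' := by
    intro P Q hP hQ
    simp only [Set.mem_ofPred_eq] at *
    rw [map_add, hP, hQ, TensorProduct.add_tmul, TensorProduct.tmul_add]
    abel
  zero_mem' := by simp
  smul_mem' := by
    intro c P hP
    simp only [Set.mem_ofPred_eq] at *
    rw [map_smul, hP, smul_add, TensorProduct.smul_tmul', TensorProduct.tmul_smul]
  lie_mem' := by
    intro P Q hP hQ
    change coproduct k P = _ at hP
    change coproduct k Q = _ at hQ
    change coproduct k _ = _
    rw [Ring.lie_def, map_sub, map_mul, map_mul, hP, hQ]
    simp only [add_mul, mul_add, Algebra.TensorProduct.tmul_mul_tmul, one_mul, mul_one,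
      TensorProduct.sub_tmul, TensorProduct.tmul_sub]
    abel

/-- The generating series `𝒴(t) = 1 + ∑_{n ≥ 1} y_n t^n`. -/
def genSeries : PowerSeries (NCPoly k) :=
  PowerSeries.mk fun n => if h : 0 < n then y k ⟨n, h⟩ else 1

variable {k} in
/-- `log S = ∑_{m ≥ 1} (-1)^(m-1)/m (S - 1)^m`, for a series `S` with constant term `1`.
The coefficient of `t^n` only involves `m ≤ n` (see `coeff_sub_one_pow`). -/
def logSeries [Algebra ℚ k] (S : PowerSeries (NCPoly k)) : PowerSeries (NCPoly k) :=
  PowerSeries.mk fun n => ∑ m ∈ Finset.Icc 1 n,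
    algebraMap ℚ k ((-1) ^ (m - 1) / (m : ℚ)) • PowerSeries.coeff n ((S - 1) ^ m)

variable {k} in
theorem coeff_sub_one_pow {S : PowerSeries (NCPoly k)} (hS : PowerSeries.constantCoeff S = 1)
    {m n : ℕ} (h : n < m) : PowerSeries.coeff n ((S - 1) ^ m) = 0 := by
  induction m generalizing n with
  | zero => omega
  | succ m ih =>
    rw [pow_succ, PowerSeries.coeff_mul]
    refine Finset.sum_eq_zero fun p hp => ?_
    rw [Finset.HasAntidiagonal.mem_antidiagonal] at hp
    rcases Nat.eq_zero_or_pos p.2 with h2 | h2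
    · have : PowerSeries.coeff p.2 (S - 1) = 0 := by
        rw [h2, PowerSeries.coeff_zero_eq_constantCoeff_apply, map_sub, hS, map_one, sub_self]
      rw [this, mul_zero]
    · rw [ih (by omega), zero_mul]

/-- The weight of a word, `w(y_{i₁} … y_{i_r}) = i₁ + … + i_r`. -/
def weight (w : YWord) : ℕ := ((FreeMonoid.toList w).map PNat.val).sum

theorem weight_mul (u v : YWord) : weight (u * v) = weight u + weight v := by
  simp [weight]

/-- The polynomials that are homogeneous of weight `n`. -/
def homog (n : ℕ) : Submodule k (NCPoly k) where
  carrier := {P | ∀ w, P.coeff w ≠ 0 → weight w = n}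
  add_mem' := by
    intro P Q hP hQ w hw
    by_contra h
    have h1 : P.coeff w = 0 := by_contra fun h' => h (hP w h')
    have h2 : Q.coeff w = 0 := by_contra fun h' => h (hQ w h')
    exact hw (by simp [h1, h2])
  zero_mem' := by intro w hw; simp at hw
  smul_mem' := by
    intro c P hP w hw
    refine hP w fun h => hw ?_
    simp [h]

theorem word_mem_homog (w : YWord) : word k w ∈ homog k (weight w) := by
  classical
  intro v hv
  by_contra h
  apply hv
  have : w ≠ v := fun e => h (by rw [e])
  simp [word, this]

theorem mul_mem_homog {a b : ℕ} {P Q : NCPoly k} (hP : P ∈ homog k a) (hQ : Q ∈ homog k b) :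
    P * Q ∈ homog k (a + b) := by
  classical
  intro w hw
  by_contra h
  apply hw
  rw [MonoidAlgebra.coeff_mul]
  refine Finset.sum_eq_zero fun u hu => Finset.sum_eq_zero fun v hv => ?_
  have h1 := hP u (Finsupp.mem_support_iff.mp hu)
  have h2 := hQ v (Finsupp.mem_support_iff.mp hv)
  refine if_neg fun e => h ?_
  rw [← e, weight_mul, h1, h2]

theorem stuffleWord_mem_homog (u v : List ℕ+) :
    stuffleWord k u v ∈ homog k (weight (.ofList u) + weight (.ofList v)) := by
  induction u, v using stuffleWord.induct with
  | case1 v =>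
    rw [stuffleWord]
    simpa [weight] using word_mem_homog k (FreeMonoid.ofList v)
  | case2 u h =>
    cases u with
    | nil => exact absurd rfl h
    | cons i u =>
      rw [stuffleWord]
      · simpa [weight] using word_mem_homog k (FreeMonoid.ofList (i :: u))
      · simp
  | case3 i u j v h1 h2 h3 =>
    rw [stuffleWord]
    have e1 := mul_mem_homog k (word_mem_homog k (FreeMonoid.of j)) h1
    have e2 := mul_mem_homog k (word_mem_homog k (FreeMonoid.of i)) h2
    have e3 := mul_mem_homog k (word_mem_homog k (FreeMonoid.of (i + j))) h3
    refine add_mem (add_mem ?_ ?_) ?_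
    · rw [y]
      convert e1 using 2
      simp [weight]; ring
    · rw [y]
      convert e2 using 2
      simp [weight]; ring
    · rw [y]
      convert e3 using 2
      simp [weight]; ring

theorem stuffleList_mem_homog (us : List YWord) :
    stuffleList k us ∈ homog k (us.map weight).sum := by
  induction us with
  | nil => exact word_mem_homog k 1
  | cons u us ih =>
    change stuffle (word k u) (stuffleList k us) ∈ _
    rw [List.map_cons, List.sum_cons]
    refine Submodule.sum_mem _ fun u' hu' => Submodule.sum_mem _ fun v hv => ?_
    have h1 := word_mem_homog k u u' (Finsupp.mem_support_iff.mp hu')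
    have h2 := ih v (Finsupp.mem_support_iff.mp hv)
    rw [← h1, ← h2]
    exact Submodule.smul_mem _ _ (stuffleWord_mem_homog k _ _)

theorem finite_list_sum_le {α : Type*} (f : α → ℕ) (n : ℕ) (hf : {a | f a ≤ n}.Finite) :
    {l : List α | (∀ a ∈ l, 1 ≤ f a) ∧ (l.map f).sum ≤ n}.Finite := by
  have : Finite {a | f a ≤ n} := hf
  refine ((List.finite_length_le {a | f a ≤ n} n).image (List.map Subtype.val)).subset ?_
  rintro l ⟨h1, h2⟩
  have h3 : ∀ a ∈ l, f a ≤ n := fun a ha =>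
    (List.le_sum_of_mem (List.mem_map_of_mem ha)).trans h2
  refine ⟨l.pmap Subtype.mk h3, ?_, ?_⟩
  · have : l.length ≤ (l.map f).sum := by
      clear h2 h3
      induction l with
      | nil => simp
      | cons a l ih =>
        have := h1 a (by simp)
        have := ih fun b hb => h1 b (by simp [hb])
        simp only [List.length_cons, List.map_cons, List.sum_cons]
        omega
    change (l.pmap Subtype.mk h3).length ≤ n
    rw [List.length_pmap]
    exact this.trans h2
  · simp [List.map_pmap]

/-- Only finitely many terms of the sum that defines `pi1` are nonzero. -/
theorem finite_support_pi1 (w : YWord) :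
    {us : List YWord | (∀ u ∈ us, u ≠ 1) ∧ (stuffleList k us).coeff w ≠ 0}.Finite := by
  have hw : {u : YWord | weight u ≤ weight w}.Finite := by
    refine (finite_list_sum_le PNat.val (weight w) ?_).subset ?_
    · exact (Set.finite_Iic (weight w)).preimage PNat.coe_injective.injOn
    · exact fun u hu => ⟨fun a _ => a.pos, hu⟩
  refine (finite_list_sum_le weight (weight w) hw).subset ?_
  rintro us ⟨h1, h2⟩
  refine ⟨fun u hu => ?_, (stuffleList_mem_homog k us w h2).ge⟩
  have h3 := h1 u hu
  rw [← FreeMonoid.ofList_toList u] at h3 ⊢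
  cases h : FreeMonoid.toList u with
  | nil => rw [h] at h3; exact absurd rfl h3
  | cons i l =>
    have := i.pos
    simp only [weight, FreeMonoid.toList_ofList, List.map_cons, List.sum_cons]
    omega

end NCPoly

end

/-! Write `L_n` for the coefficient of `t^n` in `log 𝒴(t)`, and `S` for `antipode`.

Part 1 compares coefficients of a word `w`. Since `(𝒴 - 1)^m` is the sum of all words of length `m`,
each times `t` to its weight, the coefficient of `w` in `L_n` is `(-1)^(m-1)/m` with `m` the length
of `w`, provided `w` has weight `n`, and `0` otherwise. On the other side, `y_n` occurs in a stuffle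
product of nonempty words only if these are all letters with indices of sum `n`, and then with
coefficient `1` (`coeff_stuffleList_of`). So the only factorization of `w` that counts in `π₁(y_n)`
is the one into letters.

Part 2, one inclusion: `Δ𝒴 = (𝒴 ⊗ 1)(1 ⊗ 𝒴)` with commuting factors, so `log` turns the product into
a sum and every `L_n` is primitive.

Part 2, other inclusion: a Dynkin argument. Let `E` multiply words by their weight; it is a
derivation. The convolution `S ⋆ E` sends a primitive `P` to `E P`. Since `S L_n = -L_n`, one finds
`(S ⋆ E)(P L_n) = [(S ⋆ E) P, L_n] + n (S ⋆ id)(P) L_n`, where `(S ⋆ id)(P)` is a scalar. The `L_n`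
generate `k⟨Y⟩` as an algebra, so `S ⋆ E` takes all its values in the Lie algebra generated by them
(`dynkin_induction`). This Lie algebra is graded by weight, so weights can be divided out, which
recovers `P` up to a constant, and a primitive constant is zero. -/

noncomputable section

namespace NCPoly

/-! ### The truncated logarithm and its additivity modulo powers of an ideal -/

section TruncatedLog

/-- The coefficient `(-1)^(m-1)/m` of the logarithm. -/
def logCoeff (k : Type*) [CommRing k] [Algebra ℚ k] (m : ℕ) : k :=
  algebraMap ℚ k ((-1) ^ (m - 1) / (m : ℚ))

theorem logCoeff_one (k : Type*) [CommRing k] [Algebra ℚ k] : logCoeff k 1 = 1 := by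
  simp [logCoeff]

/-- The polynomial `∑_{m=1}^N (-1)^(m-1)/m x^m`. -/
def truncLog (k : Type*) [CommRing k] [Algebra ℚ k] {T : Type*} [Ring T] [Algebra k T]
    (N : ℕ) (x : T) : T :=
  ∑ m ∈ Finset.Icc 1 N, logCoeff k m • x ^ m

theorem map_truncLog {k : Type*} [CommRing k] [Algebra ℚ k] {T U : Type*} [Ring T] [Algebra k T]
    [Ring U] [Algebra k U] (f : T →ₐ[k] U) (N : ℕ) (x : T) :
    f (truncLog k N x) = truncLog k N (f x) := by
  simp [truncLog]

theorem smul_eq_zero_of_natCast {k : Type*} [CommRing k] [Algebra ℚ k] {M : Type*}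
    [AddCommGroup M] [Module k M] {n : ℕ} (hn : n ≠ 0) {x : M} (h : (n : k) • x = 0) : x = 0 := by
  have h1 : algebraMap ℚ k (1 / n) * (n : k) = 1 := by
    rw [← map_natCast (algebraMap ℚ k) n, ← map_mul, one_div_mul_cancel (by exact_mod_cast hn),
      map_one]
  rw [← one_smul k x, ← h1, mul_smul, h, smul_zero]

variable (k : Type*) [CommRing k] [Algebra ℚ k] {C : Type*} [CommRing C] [Algebra k C]

open Polynomial in
theorem derivative_truncLog (N : ℕ) (x : C[X]) :
    (1 + x) * derivative (truncLog k N x) = (1 - (-x) ^ N) * derivative x := by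
  have h : derivative (truncLog k N x) = (∑ i ∈ Finset.range N, (-x) ^ i) * derivative x := by
    induction N with
    | zero => simp [truncLog]
    | succ N ih =>
      have e : truncLog k (N + 1) x = truncLog k N x + logCoeff k (N + 1) • x ^ (N + 1) :=
        Finset.sum_Icc_succ_top (by omega) _
      have hc : logCoeff k (N + 1) * ((N + 1 : ℕ) : k) = (-1) ^ N := by
        rw [logCoeff, ← map_natCast (algebraMap ℚ k), ← map_mul,
          div_mul_cancel₀ _ (by exact_mod_cast N.succ_ne_zero)]
        simp
      have hc' : logCoeff k (N + 1) • ((N + 1 : ℕ) : C[X]) = (-1) ^ N := by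
        rw [Algebra.smul_def, ← map_natCast (algebraMap k C[X]), ← map_mul, hc]
        simp
      rw [e, derivative_add, ih, derivative_smul, derivative_pow, Finset.sum_range_succ, add_mul,
        neg_pow x N, ← hc', add_tsub_cancel_right, smul_mul_assoc, smul_mul_assoc]
      simp
  rw [h, ← mul_assoc, ← mul_neg_geom_sum (-x) N, sub_neg_eq_add]

open Polynomial in
-- Replace `a`, `b` by `aX`, `bX` in `C[X]`. The defect `G` lies in the Rees algebra of `I`, so its
-- coefficient of degree `i` is in `I ^ i`; a derivative computation kills the degrees up to `N`.
-- Setting `X = 1` leaves only terms in `I ^ (N + 1)`.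
theorem truncLog_add_add_mul_mem_pow (I : Ideal C) {a b : C} (ha : a ∈ I) (hb : b ∈ I) (N : ℕ) :
    truncLog k N (a + b + a * b) - truncLog k N a - truncLog k N b ∈ I ^ (N + 1) := by
  set x : C[X] := monomial 1 a with hx
  set y : C[X] := monomial 1 b with hy
  set G : C[X] := truncLog k N (x + y + x * y) - truncLog k N x - truncLog k N y with hG
  have hxa : x = Polynomial.C a * X := by rw [hx, C_mul_X_eq_monomial]
  have hyb : y = Polynomial.C b * X := by rw [hy, C_mul_X_eq_monomial]
  have hmem : ∀ p ∈ reesAlgebra I, truncLog k N p ∈ reesAlgebra I := fun p hp =>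
    sum_mem fun m _ => by
      rw [← algebraMap_smul C (logCoeff k m) (p ^ m)]
      exact Subalgebra.smul_mem _ (pow_mem hp m) _
  have hxm : x ∈ reesAlgebra I := reesAlgebra.monomial_mem.mpr (by simpa using ha)
  have hym : y ∈ reesAlgebra I := reesAlgebra.monomial_mem.mpr (by simpa using hb)
  have hGm : G ∈ reesAlgebra I :=
    sub_mem (sub_mem (hmem _ (add_mem (add_mem hxm hym) (mul_mem hxm hym))) (hmem _ hxm))
      (hmem _ hym)
  have hdvd : X ^ N ∣ derivative G := by
    have h1 : ∀ c : C, IsCoprime (X ^ N : C[X]) (1 + Polynomial.C c * X) := fun c =>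
      IsCoprime.pow_left ⟨-Polynomial.C c, 1, by ring⟩
    refine (h1 a).dvd_of_dvd_mul_left ((h1 b).dvd_of_dvd_mul_left ?_)
    have e1 := derivative_truncLog k N (x + y + x * y)
    have e2 := derivative_truncLog k N x
    have e3 := derivative_truncLog k N y
    -- The logarithmic derivative of `(1 + x)(1 + y)` is additive, so only the three truncation
    -- errors survive, each divisible by `X ^ N`.
    have key : (1 + Polynomial.C b * X) * ((1 + Polynomial.C a * X) * derivative G) =
        (1 + x) * y ^ N * ((-1) ^ N * derivative y) + (1 + y) * x ^ N * ((-1) ^ N * derivative x) -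
        (x + y + x * y) ^ N * ((-1) ^ N * derivative (x + y + x * y)) := by
      rw [← hxa, ← hyb, hG]
      rw [neg_pow] at e1 e2 e3
      rw [derivative_sub, derivative_sub]
      have e4 : derivative (x + y + x * y) =
          derivative x + derivative y + (derivative x * y + x * derivative y) := by
        rw [derivative_add, derivative_add, derivative_mul]
      linear_combination e1 - (1 + y) * e2 - (1 + x) * e3 + e4
    rw [key]
    have hxd : X ^ N ∣ x ^ N := pow_dvd_pow_of_dvd (hxa ▸ dvd_mul_left _ _) N
    have hyd : X ^ N ∣ y ^ N := pow_dvd_pow_of_dvd (hyb ▸ dvd_mul_left _ _) N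
    have hxyd : X ^ N ∣ (x + y + x * y) ^ N := pow_dvd_pow_of_dvd
      (dvd_add (dvd_add (hxa ▸ dvd_mul_left _ _) (hyb ▸ dvd_mul_left _ _))
        (Dvd.dvd.mul_left (hyb ▸ dvd_mul_left _ _) _)) N
    exact dvd_sub (dvd_add ((hyd.mul_left _).mul_right _) ((hxd.mul_left _).mul_right _))
      (hxyd.mul_right _)
  have htl : ∀ (c : C) (p : C[X]), aeval c (truncLog k N p) = truncLog k N (aeval c p) :=
    fun c p => map_truncLog ((aeval c).restrictScalars k) N p
  have hcoeff : ∀ n ≤ N, G.coeff n = 0 := by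
    rintro (_ | n) hn
    · have h0 : truncLog k N (0 : C) = 0 := Finset.sum_eq_zero fun m hm => by
        rw [zero_pow (by have := (Finset.mem_Icc.mp hm).1; omega), smul_zero]
      rw [coeff_zero_eq_aeval_zero, hG]
      simp [htl, hxa, hyb, h0]
    · have h1 : (derivative G).coeff n = 0 := X_pow_dvd_iff.mp hdvd n (by omega)
      rw [coeff_derivative] at h1
      refine smul_eq_zero_of_natCast (k := k) n.succ_ne_zero ?_
      rw [Algebra.smul_def, mul_comm]
      simpa using h1
  have hev : truncLog k N (a + b + a * b) - truncLog k N a - truncLog k N b = aeval 1 G := by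
    rw [hG]
    simp [htl, hxa, hyb]
  rw [hev, aeval_eq_sum_range]
  refine sum_mem fun i _ => ?_
  rw [one_pow, smul_eq_mul, mul_one]
  rcases Nat.lt_or_ge N i with h | h
  · exact Ideal.pow_le_pow_right h (hGm i)
  · rw [hcoeff i h]
    exact zero_mem _

end TruncatedLog

/-! ### Logarithms of power series with noncommutative coefficients -/

section LogSeries

open PowerSeries

variable (k : Type*) [CommRing k] [Algebra ℚ k] {T U : Type*} [Ring T] [Algebra k T]
  [Ring U] [Algebra k U]

theorem coeff_pow_of_lt {A : T⟦X⟧} (hA : coeff 0 A = 0) {m n : ℕ} (h : n < m) :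
    coeff n (A ^ m) = 0 := by
  induction m generalizing n with
  | zero => omega
  | succ m ih =>
    rw [pow_succ, coeff_mul]
    refine Finset.sum_eq_zero fun p hp => ?_
    rw [Finset.HasAntidiagonal.mem_antidiagonal] at hp
    rcases Nat.eq_zero_or_pos p.2 with h2 | h2
    · rw [h2, hA, mul_zero]
    · rw [ih (by omega), zero_mul]

/-- The series `log (1 + A)`, for a series `A` with constant term `0`. -/
def logOneAdd (A : T⟦X⟧) : T⟦X⟧ :=
  PowerSeries.mk fun n => ∑ m ∈ Finset.Icc 1 n, logCoeff k m • coeff n (A ^ m)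

theorem coeff_logOneAdd (A : T⟦X⟧) (n : ℕ) : coeff n (logOneAdd k A) = coeff n (truncLog k n A) := by
  simp [logOneAdd, truncLog]

variable {k} in
theorem coeff_map_logOneAdd (f : T →ₐ[k] U) (A : T⟦X⟧) (n : ℕ) :
    coeff n (logOneAdd k (PowerSeries.map (f : T →+* U) A)) = f (coeff n (logOneAdd k A)) := by
  simp [logOneAdd, ← map_pow]

/-- For `I` the ideal of elements whose image has zero constant term, `I ^ (n + 1)` maps to series
of order greater than `n`, so the error of the truncated identity is invisible in degree `n`. -/
theorem coeff_truncLog_add_add_mul {C : Type*} [CommRing C] [Algebra k C] (f : C →ₐ[k] T⟦X⟧)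
    {a b : C} (ha : coeff 0 (f a) = 0) (hb : coeff 0 (f b) = 0) (n : ℕ) :
    coeff n (f (truncLog k n (a + b + a * b))) =
      coeff n (f (truncLog k n a)) + coeff n (f (truncLog k n b)) := by
  let I : Ideal C := RingHom.ker ((constantCoeff (R := T)).comp f.toRingHom)
  have hI : ∀ s : C, s ∈ I ↔ coeff 0 (f s) = 0 := fun s => by
    rw [coeff_zero_eq_constantCoeff_apply]; exact RingHom.mem_ker
  have hpow : ∀ (m : ℕ) (s : C), s ∈ I ^ m → ∀ n < m, coeff n (f s) = 0 := by
    intro m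
    induction m with
    | zero => intro s _ n hn; omega
    | succ m ih =>
      intro s hs
      rw [pow_succ] at hs
      refine Submodule.mul_induction_on hs (fun u hu v hv n hn => ?_) fun u v hu hv n hn => ?_
      · rw [map_mul, coeff_mul]
        refine Finset.sum_eq_zero fun p hp => ?_
        rw [Finset.HasAntidiagonal.mem_antidiagonal] at hp
        rcases Nat.eq_zero_or_pos p.2 with h2 | h2
        · rw [h2, (hI v).mp hv, mul_zero]
        · rw [ih u hu _ (by omega), zero_mul]
      · rw [map_add, map_add, hu n hn, hv n hn, add_zero]
  have key := hpow _ _ (truncLog_add_add_mul_mem_pow k I ((hI a).mpr ha) ((hI b).mpr hb) n) n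
    n.lt_succ_self
  rw [map_sub, map_sub, map_sub, map_sub] at key
  rwa [sub_sub, sub_eq_zero] at key

theorem logOneAdd_add_add_mul {A B : T⟦X⟧} (hA : coeff 0 A = 0) (hB : coeff 0 B = 0)
    (hAB : Commute A B) :
    logOneAdd k (A + B + A * B) = logOneAdd k A + logOneAdd k B := by
  ext n
  have hcomm : ∀ a ∈ ({A, B} : Set T⟦X⟧), ∀ b ∈ ({A, B} : Set T⟦X⟧), a * b = b * a := by
    rintro a (rfl | rfl) b (rfl | rfl)
    exacts [rfl, hAB, hAB.symm, rfl]
  have hC := Algebra.isMulCommutative_adjoin k hcomm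
  -- Commuting `A` and `B` generate a commutative subalgebra, where the commutative lemma applies.
  -- The instance extends the existing `Ring` structure, so the algebra structure is unchanged.
  let : CommRing (Algebra.adjoin k ({A, B} : Set T⟦X⟧)) :=
    { (inferInstance : Ring (Algebra.adjoin k ({A, B} : Set T⟦X⟧))) with
      mul_comm := hC.is_comm.comm }
  let a : Algebra.adjoin k ({A, B} : Set T⟦X⟧) := ⟨A, Algebra.subset_adjoin (by simp)⟩
  let b : Algebra.adjoin k ({A, B} : Set T⟦X⟧) := ⟨B, Algebra.subset_adjoin (by simp)⟩
  have key := coeff_truncLog_add_add_mul k (Algebra.adjoin k ({A, B} : Set T⟦X⟧)).val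
    (a := a) (b := b) hA hB n
  rw [map_truncLog, map_truncLog, map_truncLog] at key
  rw [map_add, coeff_logOneAdd, coeff_logOneAdd, coeff_logOneAdd]
  exact key

end LogSeries

/-! ### `𝒴(t)` is group-like and its logarithm is primitive -/

section Primitive

open PowerSeries

variable (k : Type*) [CommRing k]

theorem coeff_zero_genSeries : coeff 0 (genSeries k) = 1 := by simp [genSeries]

theorem coeff_genSeries (n : ℕ+) : coeff (n : ℕ) (genSeries k) = y k n := by
  rw [genSeries, coeff_mk, dif_pos n.pos]
  rfl

theorem coeff_zero_genSeries_sub_one : coeff 0 (genSeries k - 1) = 0 := by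
  rw [map_sub, coeff_zero_genSeries]; simp

theorem coeff_genSeries_sub_one (n : ℕ+) : coeff (n : ℕ) (genSeries k - 1) = y k n := by
  rw [map_sub, coeff_genSeries, coeff_one, if_neg n.ne_zero, sub_zero]

theorem coproduct_y (n : ℕ+) : coproduct k (y k n) = coproductLetter k n := by
  rw [coproduct, y, word, MonoidAlgebra.lift_of, FreeMonoid.lift_eval_of]

theorem map_coproduct_genSeries :
    PowerSeries.map (coproduct k : NCPoly k →+* NCPoly k ⊗[k] NCPoly k) (genSeries k) =
      PowerSeries.map (Algebra.TensorProduct.includeLeft :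
          NCPoly k →ₐ[k] NCPoly k ⊗[k] NCPoly k).toRingHom (genSeries k) *
        PowerSeries.map (Algebra.TensorProduct.includeRight :
          NCPoly k →ₐ[k] NCPoly k ⊗[k] NCPoly k).toRingHom (genSeries k) := by
  ext n
  rw [coeff_mul]
  simp only [PowerSeries.coeff_map]
  rcases Nat.eq_zero_or_pos n with rfl | hn
  · simp [coeff_zero_genSeries, Algebra.TensorProduct.one_def]
  · lift n to ℕ+ using hn
    -- Both ends of the antidiagonal are split off: they give `1 ⊗ y_n` and `y_n ⊗ 1`. The rest is
    -- the sum over `0 < i < n`, shifted by one.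
    have h1 : (n : ℕ) = n.natPred + 1 := n.natPred_add_one.symm
    rw [Finset.Nat.sum_antidiagonal_eq_sum_range_succ_mk, Finset.sum_range_succ,
      h1, Finset.sum_range_succ', ← h1]
    change coproduct k _ = _
    rw [coeff_genSeries, coproduct_y, coproductLetter]
    simp only [tsub_self, tsub_zero, coeff_zero_genSeries, coeff_genSeries, map_one, one_mul,
      mul_one]
    have h2 : ∑ i ∈ Finset.Iio n, y k i ⊗ₜ[k] y k (n - i) = ∑ i ∈ Finset.range n.natPred,
        coeff (i + 1) (genSeries k) ⊗ₜ[k] coeff ((n : ℕ) - (i + 1)) (genSeries k) := by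
      refine Finset.sum_bij' (fun i _ => i.natPred) (fun i _ => i.succPNat) ?_ ?_ ?_ ?_ ?_
      · intro i hi
        exact Finset.mem_range.mpr (PNat.natPred_lt_natPred.mpr (Finset.mem_Iio.mp hi))
      · intro i hi
        rw [Finset.mem_Iio, ← PNat.natPred_lt_natPred, Nat.natPred_succPNat]
        exact Finset.mem_range.mp hi
      · intro i _; simp
      · intro i _; simp
      · intro i hi
        rw [PNat.natPred_add_one, ← coeff_genSeries, ← coeff_genSeries, PNat.sub_coe,
          if_pos (Finset.mem_Iio.mp hi)]
    rw [h2]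
    simp only [AlgHom.toRingHom_eq_coe, RingHom.coe_coe,
      Algebra.TensorProduct.includeLeft_apply, Algebra.TensorProduct.includeRight_apply,
      Algebra.TensorProduct.tmul_mul_tmul, one_mul, mul_one]
    abel

variable [Algebra ℚ k]

theorem logSeries_genSeries : logSeries (genSeries k) = logOneAdd k (genSeries k - 1) := rfl

theorem coeff_logSeries_mem_prim (n : ℕ) : coeff n (logSeries (genSeries k)) ∈ prim k := by
  change coproduct k _ = _
  set l : NCPoly k →ₐ[k] NCPoly k ⊗[k] NCPoly k := Algebra.TensorProduct.includeLeft with hl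
  set r : NCPoly k →ₐ[k] NCPoly k ⊗[k] NCPoly k := Algebra.TensorProduct.includeRight with hr
  rw [logSeries_genSeries, ← coeff_map_logOneAdd]
  have h1 : PowerSeries.map (coproduct k : NCPoly k →+* NCPoly k ⊗[k] NCPoly k)
      (genSeries k - 1) = PowerSeries.map (l : NCPoly k →+* NCPoly k ⊗[k] NCPoly k) (genSeries k - 1) +
        PowerSeries.map (r : NCPoly k →+* NCPoly k ⊗[k] NCPoly k) (genSeries k - 1) +
        PowerSeries.map (l : NCPoly k →+* NCPoly k ⊗[k] NCPoly k) (genSeries k - 1) *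
        PowerSeries.map (r : NCPoly k →+* NCPoly k ⊗[k] NCPoly k) (genSeries k - 1) := by
    rw [map_sub, map_coproduct_genSeries, map_one, map_sub, map_sub, map_one, map_one]
    change PowerSeries.map (l : NCPoly k →+* NCPoly k ⊗[k] NCPoly k) (genSeries k) *
      PowerSeries.map (r : NCPoly k →+* NCPoly k ⊗[k] NCPoly k) (genSeries k) - 1 = _
    simp only [sub_mul, mul_sub, one_mul, mul_one]
    abel
  have h0 : ∀ f : NCPoly k →ₐ[k] NCPoly k ⊗[k] NCPoly k,
      coeff 0 (PowerSeries.map (f : NCPoly k →+* NCPoly k ⊗[k] NCPoly k) (genSeries k - 1)) = 0 := fun f => by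
    rw [PowerSeries.coeff_map, coeff_zero_genSeries_sub_one, map_zero]
  have hc : Commute (PowerSeries.map (l : NCPoly k →+* NCPoly k ⊗[k] NCPoly k) (genSeries k - 1))
      (PowerSeries.map (r : NCPoly k →+* NCPoly k ⊗[k] NCPoly k) (genSeries k - 1)) := by
    ext n
    rw [coeff_mul, coeff_mul, ← Finset.Nat.sum_antidiagonal_swap]
    refine Finset.sum_congr rfl fun p _ => ?_
    rw [Prod.fst_swap, Prod.snd_swap]
    simp only [PowerSeries.coeff_map, hl, hr, RingHom.coe_coe,
      Algebra.TensorProduct.includeLeft_apply, Algebra.TensorProduct.includeRight_apply,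
      Algebra.TensorProduct.tmul_mul_tmul, one_mul, mul_one]
  rw [h1, logOneAdd_add_add_mul k (h0 l) (h0 r) hc, map_add, coeff_map_logOneAdd,
    coeff_map_logOneAdd]
  rfl

end Primitive

/-! ### The antipode on the coefficients of the logarithm -/

section Antipode

open PowerSeries MulOpposite

/-- The series over the opposite ring with the same coefficients. -/
def opSeries {T : Type*} [Ring T] (A : T⟦X⟧) : Tᵐᵒᵖ⟦X⟧ := PowerSeries.mk fun n => op (coeff n A)

theorem opSeries_mul {T : Type*} [Ring T] (A B : T⟦X⟧) :
    opSeries (A * B) = opSeries B * opSeries A := by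
  ext n
  rw [coeff_mul, ← Finset.Nat.sum_antidiagonal_swap]
  simp [opSeries, coeff_mul]

theorem opSeries_add {T : Type*} [Ring T] (A B : T⟦X⟧) :
    opSeries (A + B) = opSeries A + opSeries B := by
  ext n; simp [opSeries]

theorem opSeries_one {T : Type*} [Ring T] : opSeries (1 : T⟦X⟧) = 1 := by
  ext n
  simp only [opSeries, coeff_mk, coeff_one]
  split_ifs <;> simp

theorem opSeries_pow {T : Type*} [Ring T] (A : T⟦X⟧) (m : ℕ) :
    opSeries (A ^ m) = opSeries A ^ m := by
  induction m with
  | zero => rw [pow_zero, pow_zero, opSeries_one]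
  | succ m ih => rw [pow_succ, opSeries_mul, ih, pow_succ']

variable (k : Type*) [CommRing k]

/-- The antipode of the stuffle Hopf algebra, which sends `𝒴(t)` to its inverse. -/
def antipode : NCPoly k →ₐ[k] (NCPoly k)ᵐᵒᵖ :=
  MonoidAlgebra.lift k _ YWord
    (FreeMonoid.lift fun n : ℕ+ => op (coeff (n : ℕ) (invOfUnit (genSeries k) 1)))

theorem map_antipode_genSeries :
    PowerSeries.map (antipode k : NCPoly k →+* (NCPoly k)ᵐᵒᵖ) (genSeries k) =
      opSeries (invOfUnit (genSeries k) 1) := by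
  ext n : 1
  rw [PowerSeries.coeff_map, opSeries, coeff_mk]
  rcases Nat.eq_zero_or_pos n with rfl | hn
  · rw [coeff_zero_genSeries]
    simp
  · lift n to ℕ+ using hn
    rw [coeff_genSeries, RingHom.coe_coe, antipode, y, word, MonoidAlgebra.lift_of,
      FreeMonoid.lift_eval_of]

variable [Algebra ℚ k]

theorem logOneAdd_opSeries {T : Type*} [Ring T] [Algebra k T] (A : T⟦X⟧) :
    logOneAdd k (opSeries A) = opSeries (logOneAdd k A) := by
  ext n
  simp only [logOneAdd, ← opSeries_pow]
  simp [opSeries]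

/-- `S` sends `𝒴` to `𝒴⁻¹`, which commutes with `𝒴`, so `log 𝒴⁻¹ + log 𝒴 = log 1 = 0`. This is the
only property of `S`, besides its being an antimorphism, that the Dynkin argument needs. -/
theorem antipode_coeff_logSeries (n : ℕ) :
    antipode k (coeff n (logSeries (genSeries k))) =
      op (-coeff n (logSeries (genSeries k))) := by
  have hu : constantCoeff (genSeries k) = ((1 : (NCPoly k)ˣ) : NCPoly k) := by
    rw [← coeff_zero_eq_constantCoeff_apply, coeff_zero_genSeries]; rfl
  set Z := invOfUnit (genSeries k) 1 with hZ
  have h1 : genSeries k * Z = 1 := mul_invOfUnit _ _ hu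
  have h2 : Z * genSeries k = 1 := invOfUnit_mul _ _ hu
  have hZ0 : coeff 0 (Z - 1) = 0 := by
    rw [map_sub, coeff_zero_eq_constantCoeff_apply, hZ, constantCoeff_invOfUnit]
    simp
  have hc : Commute (opSeries (Z - 1)) (opSeries (genSeries k - 1)) := by
    rw [Commute, SemiconjBy, ← opSeries_mul, ← opSeries_mul]
    congr 1
    rw [sub_mul, mul_sub, h1, sub_mul Z, mul_sub Z, h2]
    noncomm_ring
  have hz : opSeries (Z - 1) + opSeries (genSeries k - 1) +
      opSeries (Z - 1) * opSeries (genSeries k - 1) = 0 := by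
    rw [← opSeries_mul, ← opSeries_add, ← opSeries_add, sub_mul, mul_sub, h1]
    have : Z - 1 + (genSeries k - 1) + (1 - genSeries k * 1 - 1 * (Z - 1)) = 0 := by noncomm_ring
    rw [this]
    ext n
    simp [opSeries]
  have hop0 : ∀ A : (NCPoly k)⟦X⟧, coeff 0 A = 0 → coeff 0 (opSeries A) = 0 := fun A hA => by
    rw [opSeries, coeff_mk, hA, op_zero]
  have key := logOneAdd_add_add_mul k (hop0 _ hZ0) (hop0 _ (coeff_zero_genSeries_sub_one k)) hc
  have hl0 : logOneAdd k (0 : (NCPoly k)ᵐᵒᵖ⟦X⟧) = 0 := by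
    ext n
    rw [coeff_logOneAdd, truncLog, Finset.sum_eq_zero, map_zero]
    intro m hm
    rw [zero_pow (by have := (Finset.mem_Icc.mp hm).1; omega), smul_zero]
  rw [hz, hl0, logOneAdd_opSeries k (genSeries k - 1), ← logSeries_genSeries] at key
  have hmap : PowerSeries.map (antipode k : NCPoly k →+* (NCPoly k)ᵐᵒᵖ) (genSeries k - 1) =
      opSeries (Z - 1) := by
    rw [map_sub, map_antipode_genSeries, map_one, ← hZ]
    ext n
    simp only [opSeries, map_sub, coeff_mk, op_sub, coeff_one]
    split_ifs <;> simp
  rw [logSeries_genSeries, ← coeff_map_logOneAdd, hmap, ← logSeries_genSeries, op_neg,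
    eq_neg_of_add_eq_zero_left key.symm, map_neg]
  simp [opSeries]

end Antipode

/-! ### The coefficients of the logarithm generate the algebra -/

section Generation

open PowerSeries

variable {k : Type*} [CommRing k] {T : Type*} [Ring T] [Algebra k T]

theorem coeff_pow_mem_of_lt (S : Subalgebra k T) {A : T⟦X⟧} {n : ℕ} (hA : ∀ i < n, coeff i A ∈ S)
    (m : ℕ) : ∀ i < n, coeff i (A ^ m) ∈ S := by
  induction m with
  | zero =>
    intro i _
    rw [pow_zero, coeff_one]
    split_ifs
    exacts [one_mem _, zero_mem _]
  | succ m ih =>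
    intro i hi
    rw [pow_succ, coeff_mul]
    refine sum_mem fun p hp => ?_
    rw [Finset.HasAntidiagonal.mem_antidiagonal] at hp
    exact mul_mem (ih _ (by omega)) (hA _ (by omega))

/-- With at least two factors and no constant term, each factor contributes an index strictly below
`n`. -/
theorem coeff_pow_mem (S : Subalgebra k T) {A : T⟦X⟧} {n : ℕ} (hA : ∀ i < n, coeff i A ∈ S)
    (h0 : coeff 0 A = 0) {m : ℕ} (hm : 2 ≤ m) : coeff n (A ^ m) ∈ S := by
  obtain ⟨m, rfl⟩ := Nat.exists_eq_add_of_le' hm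
  rw [show m + 2 = (m + 1) + 1 from rfl, pow_succ, coeff_mul]
  refine sum_mem fun p hp => ?_
  rw [Finset.HasAntidiagonal.mem_antidiagonal] at hp
  rcases Nat.eq_zero_or_pos p.1 with h1 | h1
  · rw [h1, coeff_pow_of_lt h0 m.succ_pos, zero_mul]
    exact zero_mem _
  rcases Nat.eq_zero_or_pos p.2 with h2 | h2
  · rw [h2, h0, mul_zero]
    exact zero_mem _
  exact mul_mem (coeff_pow_mem_of_lt S hA _ _ (by omega)) (hA _ (by omega))

variable (k) [Algebra ℚ k]

/-- The system is triangular: `L_n` is `y_n` plus a polynomial in the `y_i` with `i < n`. -/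
theorem adjoin_coeff_logSeries :
    Algebra.adjoin k {P | ∃ n : ℕ, 1 ≤ n ∧ P = coeff n (logSeries (genSeries k))} = ⊤ := by
  set S := Algebra.adjoin k {P | ∃ n : ℕ, 1 ≤ n ∧ P = coeff n (logSeries (genSeries k))}
  have hy : ∀ n : ℕ+, y k n ∈ S := by
    intro n
    induction n using PNat.strongInductionOn with
    | _ n ih =>
      have hlt : ∀ i < (n : ℕ), coeff i (genSeries k - 1) ∈ S := by
        intro i hi
        rcases Nat.eq_zero_or_pos i with rfl | h
        · rw [coeff_zero_genSeries_sub_one]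
          exact zero_mem _
        · lift i to ℕ+ using h
          rw [coeff_genSeries_sub_one]
          exact ih i hi
      have hL : coeff (n : ℕ) (logSeries (genSeries k)) ∈ S :=
        Algebra.subset_adjoin ⟨n, n.pos, rfl⟩
      have e : coeff (n : ℕ) (logSeries (genSeries k)) = y k n + ∑ m ∈ Finset.Ioc 1 (n : ℕ),
          logCoeff k m • coeff (n : ℕ) ((genSeries k - 1) ^ m) := by
        rw [logSeries_genSeries, logOneAdd, coeff_mk, ← Finset.add_sum_Ioc_eq_sum_Icc (n.pos),
          logCoeff_one, one_smul, pow_one, coeff_genSeries_sub_one]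
      rw [eq_sub_of_add_eq e.symm]
      refine sub_mem hL (sum_mem fun m hm => Subalgebra.smul_mem _ ?_ _)
      exact coeff_pow_mem S hlt (coeff_zero_genSeries_sub_one k) (Finset.mem_Ioc.mp hm).1
  refine eq_top_iff.mpr fun P _ => ?_
  induction P using MonoidAlgebra.induction_on with
  | of w =>
    induction w using FreeMonoid.recOn with
    | one => rw [map_one]; exact one_mem _
    | of_mul n w ih => rw [map_mul]; exact mul_mem (hy n) (ih trivial)
  | add P Q hP hQ => exact add_mem (hP trivial) (hQ trivial)
  | smul c P hP => exact Subalgebra.smul_mem _ (hP trivial) c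

end Generation

/-! ### Diagonal maps and the Euler derivation -/

section WordScale

variable {k : Type*} [CommRing k]

/-- The diagonal linear map that multiplies the coefficient of each word `w` by `f w`. -/
def wordScale (f : YWord → k) : NCPoly k →ₗ[k] NCPoly k where
  toFun P := .ofCoeff (Finsupp.onFinset P.coeff.support (fun w => f w * P.coeff w) fun w hw =>
    Finsupp.mem_support_iff.mpr (right_ne_zero_of_mul hw))
  map_add' P Q := by ext w; exact mul_add _ _ _
  map_smul' c P := by ext w; exact mul_left_comm _ _ _

theorem coeff_wordScale (f : YWord → k) (P : NCPoly k) (w : YWord) :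
    (wordScale f P).coeff w = f w * P.coeff w := rfl

theorem wordScale_single (f : YWord → k) (w : YWord) (c : k) :
    wordScale f (MonoidAlgebra.single w c) = MonoidAlgebra.single w (f w * c) := by
  classical
  ext v
  rw [coeff_wordScale, MonoidAlgebra.coeff_single, MonoidAlgebra.coeff_single,
    Finsupp.single_apply, Finsupp.single_apply]
  split_ifs with h
  · rw [h]
  · rw [mul_zero]

theorem wordScale_of_mem_homog (f : ℕ → k) {n : ℕ} {P : NCPoly k} (hP : P ∈ homog k n) :
    wordScale (fun w => f (weight w)) P = f n • P := by
  ext w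
  rw [coeff_wordScale, MonoidAlgebra.coeff_smul_apply, smul_eq_mul]
  by_cases h : P.coeff w = 0
  · rw [h, mul_zero, mul_zero]
  · rw [hP w h]

variable (k)

/-- The derivation that multiplies each word by its weight. -/
def euler : NCPoly k →ₗ[k] NCPoly k := wordScale fun w => (weight w : k)

theorem euler_mul (P Q : NCPoly k) : euler k (P * Q) = euler k P * Q + P * euler k Q := by
  induction P using MonoidAlgebra.induction_linear with
  | zero => simp
  | add P P' h h' => simp only [add_mul, map_add, h, h']; abel
  | single u a =>
    induction Q using MonoidAlgebra.induction_linear with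
    | zero => simp
    | add P P' h h' => simp only [mul_add, map_add, h, h']; abel
    | single v b =>
      simp only [euler, wordScale_single, MonoidAlgebra.single_mul_single, weight_mul,
        ← MonoidAlgebra.single_add]
      congr 1
      push_cast
      ring

theorem euler_one : euler k 1 = 0 := by
  rw [MonoidAlgebra.one_def, euler, wordScale_single]
  simp [weight]

end WordScale

/-! ### The weight grading of the Lie algebra -/

section Homogeneous

open PowerSeries

variable (k : Type*) [CommRing k]

theorem coeff_genSeries_sub_one_pow_mem_homog (m n : ℕ) :
    coeff n ((genSeries k - 1) ^ m) ∈ homog k n := by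
  induction m generalizing n with
  | zero =>
    rw [pow_zero, coeff_one]
    split_ifs with h
    · rw [h]; exact word_mem_homog k 1
    · exact zero_mem _
  | succ m ih =>
    rw [pow_succ, coeff_mul]
    refine sum_mem fun p hp => ?_
    rw [Finset.HasAntidiagonal.mem_antidiagonal] at hp
    rw [← hp]
    refine mul_mem_homog k (ih _) ?_
    rcases Nat.eq_zero_or_pos p.2 with h | h
    · rw [h, coeff_zero_genSeries_sub_one]; exact zero_mem _
    · lift p.2 to ℕ+ using h with i
      rw [coeff_genSeries_sub_one]
      have := word_mem_homog k (FreeMonoid.of i)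
      rwa [weight, FreeMonoid.toList_of, List.map_singleton, List.sum_singleton] at this

variable [Algebra ℚ k]

theorem coeff_logSeries_mem_homog (n : ℕ) : coeff n (logSeries (genSeries k)) ∈ homog k n := by
  rw [logSeries_genSeries, logOneAdd, coeff_mk]
  exact sum_mem fun m _ => Submodule.smul_mem _ _ (coeff_genSeries_sub_one_pow_mem_homog k m n)

/-- The Lie algebra generated by the coefficients of `log 𝒴(t)`. -/
abbrev logLie : LieSubalgebra k (NCPoly k) :=
  LieSubalgebra.lieSpan k (NCPoly k)
    {P | ∃ n : ℕ, 1 ≤ n ∧ P = coeff n (logSeries (genSeries k))}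

theorem logLie_le_iSup_homog {P : NCPoly k} (hP : P ∈ logLie k) :
    P ∈ ⨆ n, (logLie k).toSubmodule ⊓ homog k n := by
  induction hP using LieSubalgebra.lieSpan_induction with
  | mem P h =>
    obtain ⟨n, hn, rfl⟩ := h
    exact Submodule.mem_iSup_of_mem n
      ⟨LieSubalgebra.subset_lieSpan ⟨n, hn, rfl⟩, coeff_logSeries_mem_homog k n⟩
  | zero => exact zero_mem _
  | add P Q _ _ hP hQ => exact add_mem hP hQ
  | smul c P _ hP => exact Submodule.smul_mem _ _ hP
  | lie P Q hP' hQ' hP hQ =>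
    clear hP' hQ'
    induction hP using Submodule.iSup_induction' with
    | zero => rw [zero_lie]; exact zero_mem _
    | add P P' _ _ h h' => rw [add_lie]; exact add_mem h h'
    | mem a P hPa =>
      induction hQ using Submodule.iSup_induction' with
      | zero => rw [lie_zero]; exact zero_mem _
      | add Q Q' _ _ h h' => rw [lie_add]; exact add_mem h h'
      | mem b Q hQb =>
        refine Submodule.mem_iSup_of_mem (a + b) ⟨LieSubalgebra.lie_mem _ hPa.1 hQb.1, ?_⟩
        rw [Ring.lie_def]
        refine sub_mem (mul_mem_homog k hPa.2 hQb.2) ?_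
        rw [add_comm]
        exact mul_mem_homog k hQb.2 hPa.2

/-- Such a map acts by a scalar on each homogeneous component, hence preserves a graded subspace.
With `f n = 1 / n` this inverts `E` in positive weight. -/
theorem wordScale_mem_logLie (f : ℕ → k) {P : NCPoly k} (hP : P ∈ logLie k) :
    wordScale (fun w => f (weight w)) P ∈ logLie k := by
  replace hP := logLie_le_iSup_homog k hP
  induction hP using Submodule.iSup_induction' with
  | zero => rw [map_zero]; exact zero_mem _
  | add P P' _ _ h h' => rw [map_add]; exact add_mem h h'
  | mem n P h =>
    rw [wordScale_of_mem_homog f h.2]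
    exact LieSubalgebra.smul_mem _ _ h.1

end Homogeneous

/-! ### The Dynkin argument -/

section Dynkin

open PowerSeries MulOpposite

variable (k : Type*) [CommRing k]

/-- The linear map `m ∘ (S ⊗ f)`, where `S` is the antipode and `m` the concatenation. -/
def antipodeTensor (f : NCPoly k →ₗ[k] NCPoly k) : NCPoly k ⊗[k] NCPoly k →ₗ[k] NCPoly k :=
  LinearMap.mul' k (NCPoly k) ∘ₗ
    TensorProduct.map ((opLinearEquiv k).symm.toLinearMap ∘ₗ (antipode k).toLinearMap) f

theorem antipodeTensor_tmul (f : NCPoly k →ₗ[k] NCPoly k) (P Q : NCPoly k) :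
    antipodeTensor k f (P ⊗ₜ Q) = unop (antipode k P) * f Q := by
  simp [antipodeTensor]

variable {k} in
-- `S` reverses products, so `L ⊗ 1` produces `-L` on the left, while `1 ⊗ L` produces `L` on the
-- right and the defect `g`; together they form a commutator. It is used for `f = id`, `g = 0` and
-- for `f = E`, `g` right multiplication by `E L`.
theorem antipodeTensor_mul {L : NCPoly k} (hL : antipode k L = op (-L))
    (f g : NCPoly k →ₗ[k] NCPoly k) (hf : ∀ Q, f (Q * L) = f Q * L + g Q)
    (t : NCPoly k ⊗[k] NCPoly k) :
    antipodeTensor k f (t * (L ⊗ₜ 1 + 1 ⊗ₜ L)) =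
      ⁅antipodeTensor k f t, L⁆ + antipodeTensor k g t := by
  induction t using TensorProduct.induction_on with
  | zero => simp
  | add t t' h h' => rw [add_mul, map_add, h, h', map_add, map_add, add_lie]; abel
  | tmul P Q =>
    simp only [mul_add, Algebra.TensorProduct.tmul_mul_tmul, mul_one, map_add,
      antipodeTensor_tmul, hf, map_mul, hL, Ring.lie_def, unop_mul, unop_op, neg_mul, mul_assoc]
    abel

/-- Multiplying the two tensor factors together turns primitivity into `c = c + c`. -/
theorem smul_one_mem_prim {c : k} (hc : c • (1 : NCPoly k) ∈ prim k) : c • (1 : NCPoly k) = 0 := by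
  have h : coproduct k (c • 1) = (c • 1) ⊗ₜ 1 + 1 ⊗ₜ (c • 1) := hc
  have h' := congrArg (LinearMap.mul' k (NCPoly k)) h
  rw [map_smul, map_one, map_smul, map_add, Algebra.TensorProduct.one_def,
    LinearMap.mul'_apply, LinearMap.mul'_apply, LinearMap.mul'_apply, mul_one, mul_one,
    one_mul] at h'
  exact left_eq_add.mp h'

variable [Algebra ℚ k]

theorem dynkin_induction (P : NCPoly k) :
    antipodeTensor k LinearMap.id (coproduct k P) ∈
        LinearMap.range (Algebra.linearMap k (NCPoly k)) ∧
      antipodeTensor k (euler k) (coproduct k P) ∈ logLie k := by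
  set s := {P | ∃ n : ℕ, 1 ≤ n ∧ P = coeff n (logSeries (genSeries k))} with hs
  -- The induction runs over monomials in the `L_n` instead of words, because `Δ` and `S` are
  -- simplest on the `L_n`. The statement on `S ⋆ id` is carried along since its scalar value enters
  -- the step for `S ⋆ E`.
  have hP : P ∈ Submodule.span k (Submonoid.closure s : Set (NCPoly k)) := by
    rw [← Algebra.adjoin_eq_span, adjoin_coeff_logSeries]
    trivial
  induction hP using Submodule.span_induction with
  | zero => simp only [map_zero]; exact ⟨zero_mem _, zero_mem _⟩
  | add P Q _ _ hP hQ =>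
    simp only [map_add]
    exact ⟨add_mem hP.1 hQ.1, add_mem hP.2 hQ.2⟩
  | smul c P _ hP =>
    simp only [map_smul]
    exact ⟨Submodule.smul_mem _ _ hP.1, LieSubalgebra.smul_mem _ _ hP.2⟩
  | mem P hP =>
    induction hP using Submonoid.closure_induction_right with
    | one =>
      rw [map_one, Algebra.TensorProduct.one_def, antipodeTensor_tmul, antipodeTensor_tmul,
        euler_one, mul_zero, map_one]
      exact ⟨⟨1, by simp [MonoidAlgebra.one_def]⟩, zero_mem _⟩
    | mul_right P _ L hL ih =>
      obtain ⟨n, hn, rfl⟩ := hL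
      set L := coeff n (logSeries (genSeries k)) with hLn
      have hLL : L ∈ logLie k := LieSubalgebra.subset_lieSpan ⟨n, hn, hLn⟩
      have hS : antipode k L = op (-L) := antipode_coeff_logSeries k n
      have hp : coproduct k L = L ⊗ₜ 1 + 1 ⊗ₜ L := coeff_logSeries_mem_prim k n
      have hE : euler k L = (n : k) • L :=
        wordScale_of_mem_homog (fun m => (m : k)) (coeff_logSeries_mem_homog k n)
      obtain ⟨⟨c, hc⟩, hF⟩ := ih
      have hg : ∀ t, antipodeTensor k (LinearMap.mulRight k (euler k L)) t =
          antipodeTensor k LinearMap.id t * euler k L := fun t => by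
        induction t using TensorProduct.induction_on with
        | zero => simp
        | add t t' h h' => rw [map_add, map_add, h, h', add_mul]
        | tmul P Q => simp [antipodeTensor_tmul, mul_assoc]
      rw [map_mul, hp, antipodeTensor_mul hS LinearMap.id 0 (by simp),
        antipodeTensor_mul hS (euler k) (LinearMap.mulRight k (euler k L))
          (fun Q => by rw [euler_mul, LinearMap.mulRight_apply]), hg, ← hc, hE]
      have h0 : antipodeTensor k 0 = 0 := by simp [antipodeTensor]
      refine ⟨⟨0, ?_⟩, add_mem (LieSubalgebra.lie_mem _ hF hLL) ?_⟩
      · rw [h0, map_zero, LinearMap.zero_apply, add_zero, Ring.lie_def, Algebra.linearMap_apply,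
          Algebra.commutes, sub_self]
      · rw [Algebra.linearMap_apply, ← Algebra.smul_def]
        exact LieSubalgebra.smul_mem _ _ (LieSubalgebra.smul_mem _ _ hLL)

theorem logLie_le_prim : logLie k ≤ prim k := by
  rw [LieSubalgebra.lieSpan_le]
  rintro P ⟨n, -, rfl⟩
  exact coeff_logSeries_mem_prim k n

theorem euler_mem_logLie {P : NCPoly k} (hP : P ∈ prim k) : euler k P ∈ logLie k := by
  have h := (dynkin_induction k P).2
  have hp : coproduct k P = P ⊗ₜ 1 + 1 ⊗ₜ P := hP
  rw [hp, map_add, antipodeTensor_tmul, antipodeTensor_tmul, euler_one, mul_zero, zero_add,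
    map_one, unop_one, one_mul] at h
  exact h

theorem prim_le_logLie : prim k ≤ logLie k := by
  intro P hP
  -- At weight `0` the value is `1 / 0 = 0`; the empty word is already killed by `E`, so `Q` is `P`
  -- without its constant term.
  let f : ℕ → k := fun n => algebraMap ℚ k (1 / n)
  have h1 := wordScale_mem_logLie k f (euler_mem_logLie k hP)
  set Q := wordScale (fun w => f (weight w)) (euler k P) with hQ
  have h2 : P - Q = P.coeff 1 • (1 : NCPoly k) := by
    classical
    ext w
    rw [MonoidAlgebra.coeff_sub, Finsupp.sub_apply, hQ, coeff_wordScale, euler, coeff_wordScale,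
      MonoidAlgebra.coeff_smul_apply, MonoidAlgebra.one_def, MonoidAlgebra.coeff_single, Finsupp.single_apply,
      ← mul_assoc]
    by_cases hw : w = 1
    · subst hw
      simp [weight]
    · have h3 : weight w ≠ 0 := by
        induction w using FreeMonoid.recOn with
        | one => exact absurd rfl hw
        | of_mul n w _ =>
          have := n.pos
          rw [weight_mul]
          simp [weight]
      have h4 : f (weight w) * (weight w : k) = 1 := by
        rw [← map_natCast (algebraMap ℚ k), ← map_mul,
          one_div_mul_cancel (by exact_mod_cast h3), map_one]
      rw [h4, one_mul, sub_self, if_neg (Ne.symm hw), smul_zero]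
  have h3 : P - Q = 0 := by
    have : P - Q ∈ prim k := sub_mem hP (logLie_le_prim k h1)
    rw [h2] at this ⊢
    exact smul_one_mem_prim k this
  rw [sub_eq_zero.mp h3]
  exact h1

end Dynkin

/-! ### Word coefficients of `log 𝒴(t)` and of `π₁(y_n)` -/

section LetterCoefficients

open PowerSeries

variable (k : Type*) [CommRing k]

theorem prod_map_of {α : Type*} (l : List α) :
    (l.map FreeMonoid.of).prod = FreeMonoid.ofList l := by
  induction l with
  | nil => rfl
  | cons a l ih => rw [List.map_cons, List.prod_cons, ih, FreeMonoid.ofList_cons]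

theorem coeff_word (u w : YWord) [Decidable (u = w)] :
    (word k u).coeff w = if u = w then 1 else 0 := by
  rw [word, MonoidAlgebra.of_apply, MonoidAlgebra.coeff_single, Finsupp.single_apply]

theorem coeff_y_mul_one (i : ℕ+) (P : NCPoly k) : (y k i * P).coeff 1 = 0 :=
  MonoidAlgebra.coeff_single_mul_of_forall_mul_ne _ _ fun d h => by
    have := congrArg FreeMonoid.length h
    simp at this

theorem coeff_y_mul_of_mul (i j : ℕ+) (P : NCPoly k) (w : YWord) :
    (y k i * P).coeff (FreeMonoid.of j * w) = if i = j then P.coeff w else 0 := by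
  split_ifs with h
  · subst h
    have := MonoidAlgebra.coeff_single_mul_eq_mul_coeff (x := P) (r := 1)
      (m := FreeMonoid.of i) (m₁ := FreeMonoid.of i * w) w fun m' _ => mul_right_inj _
    rw [one_mul] at this
    exact this
  · refine MonoidAlgebra.coeff_single_mul_of_forall_mul_ne _ _ fun d h' => h ?_
    exact (List.cons.inj h').1

theorem coeff_y_mul_of (i j : ℕ+) (P : NCPoly k) :
    (y k i * P).coeff (FreeMonoid.of j) = if i = j then P.coeff 1 else 0 := by
  rw [← coeff_y_mul_of_mul, mul_one]

theorem coeff_genSeries_sub_one_pow (m n : ℕ) (w : YWord) :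
    (coeff n ((genSeries k - 1) ^ m)).coeff w =
      if w.length = m ∧ weight w = n then 1 else 0 := by
  classical
  induction m generalizing n w with
  | zero =>
    rw [pow_zero, coeff_one]
    by_cases hw : w = 1
    · subst hw
      have h1 : weight 1 = 0 := rfl
      rw [h1, FreeMonoid.length_one]
      by_cases h : n = 0
      · rw [if_pos h, if_pos ⟨rfl, h.symm⟩, MonoidAlgebra.coeff_one_one]
      · rw [if_neg h, if_neg (fun h' => h h'.2.symm)]; rfl
    · rw [if_neg (c := _ ∧ _) (fun h => hw (FreeMonoid.length_eq_zero.mp h.1))]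
      split_ifs
      · rw [MonoidAlgebra.one_def, MonoidAlgebra.coeff_single, Finsupp.single_apply,
          if_neg (Ne.symm hw)]
      · rfl
  | succ m ih =>
    rw [pow_succ', coeff_mul, MonoidAlgebra.coeff_sum, Finsupp.finsetSum_apply]
    induction w using FreeMonoid.recOn with
    | one =>
      rw [if_neg (by simp)]
      refine Finset.sum_eq_zero fun p _ => ?_
      rcases Nat.eq_zero_or_pos p.1 with h | h
      · rw [h, coeff_zero_genSeries_sub_one, zero_mul]; rfl
      · lift p.1 to ℕ+ using h with i
        rw [coeff_genSeries_sub_one, coeff_y_mul_one]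
    | of_mul j w _ =>
      have hterm : ∀ p ∈ Finset.HasAntidiagonal.antidiagonal n,
          (coeff p.1 (genSeries k - 1) * coeff p.2 ((genSeries k - 1) ^ m)).coeff
            (FreeMonoid.of j * w) =
          if p.1 = j then (if w.length = m ∧ weight w = p.2 then 1 else 0) else 0 := by
        intro p _
        rcases Nat.eq_zero_or_pos p.1 with h | h
        · rw [h, coeff_zero_genSeries_sub_one, zero_mul, if_neg j.ne_zero.symm]; rfl
        · lift p.1 to ℕ+ using h with i
          rw [coeff_genSeries_sub_one, coeff_y_mul_of_mul, ih]
          simp only [PNat.coe_inj]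
      rw [Finset.sum_congr rfl hterm]
      have hw : weight (FreeMonoid.of j * w) = j + weight w := by
        rw [weight_mul]; simp [weight]
      have hl : (FreeMonoid.of j * w).length = w.length + 1 := by
        rw [FreeMonoid.length_mul, FreeMonoid.length_of, add_comm]
      rw [hw, hl]
      split_ifs with h
      · obtain ⟨h1, rfl⟩ := h
        rw [Finset.sum_eq_single ((j : ℕ), weight w)]
        · exact (if_pos rfl).trans (if_pos ⟨by omega, rfl⟩)
        · rintro ⟨a, b⟩ hab hne
          rw [Finset.HasAntidiagonal.mem_antidiagonal] at hab
          dsimp only at hab ⊢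
          split_ifs with h3 h4
          · exact absurd (Prod.ext h3 h4.2.symm) hne
          · rfl
          · rfl
        · intro h3
          simp at h3
      · refine Finset.sum_eq_zero fun p hp => ?_
        rw [Finset.HasAntidiagonal.mem_antidiagonal] at hp
        split_ifs with h3 h4
        · exact absurd ⟨by omega, by omega⟩ h
        · rfl
        · rfl

theorem coeff_stuffleWord_nil (u v : List ℕ+) :
    (stuffleWord k u v).coeff 1 = if u = [] ∧ v = [] then 1 else 0 := by
  classical
  match u, v with
  | [], v =>
    rw [stuffleWord, coeff_word]
    exact if_congr (FreeMonoid.ofList.injective.eq_iff (b := []) |>.trans (by simp)) rfl rfl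
  | i :: u, [] =>
    rw [stuffleWord, coeff_word]
    · exact if_congr (FreeMonoid.ofList.injective.eq_iff (b := []) |>.trans (by simp)) rfl rfl
    · simp
  | i :: u, j :: v =>
    rw [stuffleWord]
    simp [coeff_y_mul_one]

open Classical in
/-- The coefficient of a letter in the stuffle product of two words, the first one nonempty. -/
theorem coeff_stuffleWord_of (i : ℕ+) (u v : List ℕ+) (n : ℕ+) :
    (stuffleWord k (i :: u) v).coeff (FreeMonoid.of n) =
      if u = [] ∧ (v = [] ∧ i = n ∨ ∃ j, v = [j] ∧ i + j = n) then 1 else 0 := by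
  classical
  match v with
  | [] =>
    rw [stuffleWord, coeff_word]
    · exact if_congr (FreeMonoid.ofList.injective.eq_iff (b := [n]) |>.trans
        (by simp [and_comm])) rfl rfl
    · simp
  | j :: v =>
    rw [stuffleWord]
    simp only [MonoidAlgebra.coeff_add, Finsupp.add_apply, coeff_y_mul_of, coeff_stuffleWord_nil]
    -- The first two terms of the recursion put a letter before a stuffle product with a nonempty
    -- factor, which has no constant term; only `y_{i+j} (u ∗ v)` can yield a single letter.
    simp only [reduceCtorEq, false_and, and_false, if_false, ite_self, zero_add]
    by_cases hu : u = [] <;> by_cases hv : v = [] <;> by_cases hn : i + j = n <;>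
      simp [hu, hv, hn]

theorem coeff_stuffle_word (u w : YWord) (Q : NCPoly k) :
    (stuffle (word k u) Q).coeff w = Q.coeff.sum fun v b =>
      b * (stuffleWord k (FreeMonoid.toList u) (FreeMonoid.toList v)).coeff w := by
  rw [stuffle, word, MonoidAlgebra.of_apply, MonoidAlgebra.coeff_single,
    Finsupp.sum_single_index (by simp)]
  rw [MonoidAlgebra.coeff_finsuppSum, Finsupp.sum_apply]
  simp

theorem coeff_stuffleList_one {us : List YWord} (hus : ∀ u ∈ us, u ≠ 1) :
    (stuffleList k us).coeff 1 = if us = [] then 1 else 0 := by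
  cases us with
  | nil => simp [stuffleList]
  | cons u us =>
    change (stuffle (word k u) (stuffleList k us)).coeff 1 = _
    rw [coeff_stuffle_word, if_neg (by simp)]
    refine Finset.sum_eq_zero fun v _ => ?_
    dsimp only
    have hu : FreeMonoid.toList u ≠ [] := hus u (by simp)
    rw [coeff_stuffleWord_nil, if_neg fun h => hu h.1, mul_zero]

open Classical in
-- The coefficient of `y_n` in `y_i ∗ Q` is that of `y_{n-i}` in `Q` if `i < n`, the constant term
-- of `Q` if `i = n`, and `0` if `i > n`; a longer first word gives `0`.
theorem coeff_stuffleList_of {us : List YWord} (hus : ∀ u ∈ us, u ≠ 1) (n : ℕ+) :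
    (stuffleList k us).coeff (FreeMonoid.of n) =
      if (∃ l : List ℕ+, us = l.map FreeMonoid.of ∧ (l.map PNat.val).sum = n) then 1 else 0 := by
  induction us generalizing n with
  | nil =>
    have : ¬ ∃ l : List ℕ+, ([] : List YWord) = l.map FreeMonoid.of ∧
        (l.map PNat.val).sum = n := by
      rintro ⟨l, h1, h2⟩
      rw [List.map_eq_nil_iff.mp h1.symm] at h2
      exact n.ne_zero h2.symm
    rw [if_neg this, stuffleList, List.foldr_nil, MonoidAlgebra.one_def,
      MonoidAlgebra.coeff_single, Finsupp.single_apply, if_neg (FreeMonoid.one_ne_of n)]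
  | cons u us ih =>
    have ih' := ih fun v hv => hus v (List.mem_cons_of_mem _ hv)
    have h1 := coeff_stuffleList_one k fun v hv => hus v (List.mem_cons_of_mem u hv)
    change (stuffle (word k u) (stuffleList k us)).coeff _ = _
    rw [coeff_stuffle_word]
    obtain ⟨i, u', hu⟩ := List.exists_cons_of_ne_nil (show FreeMonoid.toList u ≠ [] from
      hus u (by simp))
    simp only [hu, coeff_stuffleWord_of]
    by_cases hu' : u' = []
    swap
    · rw [if_neg]
      · refine Finset.sum_eq_zero fun v _ => ?_
        dsimp only
        rw [if_neg (fun h => hu' h.1), mul_zero]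
      · rintro ⟨l, h2, -⟩
        cases l with
        | nil => simp at h2
        | cons j l =>
          have h3 : u = FreeMonoid.of j := (List.cons.inj h2).1
          rw [h3, FreeMonoid.toList_of] at hu
          exact hu' (List.cons.inj hu).2.symm
    subst hu'
    have hui : u = FreeMonoid.of i := hu
    subst hui
    -- At most one word `v` of `Q` contributes to `y_n`, so the sum over the support collapses to
    -- one coefficient.
    have key : ∀ v : YWord, FreeMonoid.toList v = [] ∧ i = n ∨
        (∃ j, FreeMonoid.toList v = [j] ∧ i + j = n) → ∀ v' : YWord, v' ≠ v →
        ¬ (FreeMonoid.toList v' = [] ∧ i = n ∨ ∃ j, FreeMonoid.toList v' = [j] ∧ i + j = n) := by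
      rintro v (⟨h2, h3⟩ | ⟨j, h2, h3⟩) v' hv' (⟨h4, h5⟩ | ⟨j', h4, h5⟩)
      · exact hv' (FreeMonoid.toList.injective (h4.trans h2.symm))
      · exact absurd (h5.trans h3.symm) (PNat.lt_add_right i j').ne'
      · exact absurd (h3.trans h5.symm) (PNat.lt_add_right i j).ne'
      · rw [← h3] at h5
        rw [add_left_cancel h5] at h4
        exact hv' (FreeMonoid.toList.injective (h4.trans h2.symm))
    have hsum : ∀ v : YWord, (FreeMonoid.toList v = [] ∧ i = n ∨
        (∃ j, FreeMonoid.toList v = [j] ∧ i + j = n)) →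
        ((stuffleList k us).coeff.sum fun v b => b * if [] = ([] : List ℕ+) ∧
          (FreeMonoid.toList v = [] ∧ i = n ∨ ∃ j, FreeMonoid.toList v = [j] ∧ i + j = n)
          then 1 else 0) = (stuffleList k us).coeff v := by
      intro v hv
      rw [Finsupp.sum, Finset.sum_eq_single v]
      · rw [if_pos ⟨rfl, hv⟩, mul_one]
      · intro v' _ h'
        rw [if_neg (fun h => key v hv v' h' h.2), mul_zero]
      · intro h
        rw [Finsupp.notMem_support_iff.mp h, zero_mul]
    have hex : (∃ l : List ℕ+, FreeMonoid.of i :: us = l.map FreeMonoid.of ∧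
        (l.map PNat.val).sum = n) ↔
        ∃ l : List ℕ+, us = l.map FreeMonoid.of ∧ i + (l.map PNat.val).sum = (n : ℕ) := by
      constructor
      · rintro ⟨l, h2, h3⟩
        cases l with
        | nil => simp at h2
        | cons j l =>
          have h4 : i = j := FreeMonoid.of_injective (List.cons.inj h2).1
          subst h4
          exact ⟨l, (List.cons.inj h2).2, by simpa using h3⟩
      · rintro ⟨l, h2, h3⟩
        exact ⟨i :: l, by rw [h2, List.map_cons], by simpa using h3⟩
    rw [if_congr hex rfl rfl]
    rcases lt_trichotomy i n with h | h | h
    · obtain ⟨j, rfl⟩ : ∃ j, n = i + j := ⟨n - i, (PNat.add_sub_of_lt h).symm⟩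
      rw [hsum (FreeMonoid.of j) (Or.inr ⟨j, rfl, rfl⟩), ih']
      refine if_congr (exists_congr fun l => and_congr_right fun _ => ?_) rfl rfl
      rw [PNat.add_coe, Nat.add_left_cancel_iff]
    · rw [hsum 1 (Or.inl ⟨rfl, h⟩), h1]
      refine if_congr ⟨?_, ?_⟩ rfl rfl
      · rintro rfl
        exact ⟨[], rfl, by simp [h]⟩
      · rintro ⟨l, rfl, h3⟩
        cases l with
        | nil => rfl
        | cons j l =>
          have := j.pos
          rw [h] at h3
          simp at h3
    · rw [if_neg]
      · refine Finset.sum_eq_zero fun v _ => ?_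
        dsimp only
        rw [if_neg, mul_zero]
        rintro ⟨-, ⟨-, h2⟩ | ⟨j, -, h2⟩⟩
        · exact h.ne' h2
        · rw [← h2] at h
          exact absurd h (PNat.lt_add_right i j).not_gt
      · rintro ⟨l, -, h2⟩
        have : (n : ℕ) < i := h
        omega

variable [Algebra ℚ k]

theorem coeff_coeff_logSeries (n : ℕ+) (w : YWord) :
    (coeff (n : ℕ) (logSeries (genSeries k))).coeff w =
      if weight w = n then logCoeff k w.length else 0 := by
  rw [logSeries_genSeries, logOneAdd, coeff_mk, MonoidAlgebra.coeff_sum, Finsupp.finsetSum_apply]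
  simp only [MonoidAlgebra.coeff_smul_apply, coeff_genSeries_sub_one_pow, smul_eq_mul, mul_ite,
    mul_one, mul_zero]
  by_cases h : weight w = n
  · simp only [h, and_true, if_true]
    rw [Finset.sum_ite_eq, if_pos]
    -- Indices are at least `1`, so the exponent `m = w.length` lies within the truncation `m ≤ n`.
    have h1 : w.length ≤ weight w := by
      have := List.length_le_sum_of_one_le ((FreeMonoid.toList w).map PNat.val) (by
        intro i hi
        obtain ⟨j, -, rfl⟩ := List.mem_map.mp hi
        exact j.pos)
      rwa [List.length_map] at this
    have h2 : w.length ≠ 0 := fun h0 => by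
      rw [FreeMonoid.length_eq_zero.mp h0] at h
      exact n.ne_zero h.symm
    exact Finset.mem_Icc.mpr ⟨by omega, h ▸ h1⟩
  · simp [h]

theorem coeff_pi1_of (n : ℕ+) (w : YWord) :
    (pi1 k (FreeMonoid.of n)).coeff w = if weight w = n then logCoeff k w.length else 0 := by
  classical
  set S : Set (List YWord) := {us | 2 ≤ us.length ∧ ∀ u ∈ us, u ≠ 1} with hS
  set F : List YWord → NCPoly k := fun us => (algebraMap ℚ k
    ((-1) ^ (us.length - 1) / (us.length : ℚ)) * (stuffleList k us).coeff (FreeMonoid.of n)) •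
      word k us.prod with hF
  have hfin : (S ∩ Function.support F).Finite :=
    (finite_support_pi1 k (FreeMonoid.of n)).subset fun us hus =>
      ⟨hus.1.2, fun h => hus.2 (by rw [hF]; dsimp only; rw [h, mul_zero, zero_smul])⟩
  let φ : NCPoly k →+ k := (Finsupp.applyAddHom w).comp MonoidAlgebra.coeffAddEquiv.toAddMonoidHom
  have hφ : ∀ P : NCPoly k, φ P = P.coeff w := fun _ => rfl
  have h1 : (∑ᶠ us ∈ S, F us : NCPoly k).coeff w = ∑ᶠ us ∈ S, (F us).coeff w :=
    φ.map_finsum_mem' hfin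
  set us₀ : List YWord := (FreeMonoid.toList w).map FreeMonoid.of with hus₀
  have hprod : us₀.prod = w := by
    rw [hus₀, prod_map_of, FreeMonoid.ofList_toList]
  have hlen : us₀.length = w.length := List.length_map _
  have hne : ∀ u ∈ us₀, u ≠ 1 := fun u hu => by
    obtain ⟨i, -, rfl⟩ := List.mem_map.mp hu
    exact FreeMonoid.of_ne_one i
  have hz : ∀ us ∈ S, us ≠ us₀ → (F us).coeff w = 0 := by
    intro us hus hne
    rw [hF]
    dsimp only
    rw [MonoidAlgebra.coeff_smul_apply, coeff_stuffleList_of k hus.2]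
    split_ifs with h
    · obtain ⟨l, rfl, -⟩ := h
      rw [coeff_word, if_neg, smul_zero]
      intro h
      refine hne ?_
      rw [hus₀, ← h, prod_map_of, FreeMonoid.toList_ofList]
    · rw [mul_zero, zero_smul]
  have h2 : ∑ᶠ us ∈ S, (F us).coeff w = if us₀ ∈ S then (F us₀).coeff w else 0 := by
    rw [finsum_eq_single _ us₀]
    · by_cases h : us₀ ∈ S <;> simp [h]
    · intro us hne
      by_cases h : us ∈ S
      · simp [h, hz us h hne]
      · simp [h]
  have h3 : (F us₀).coeff w = if weight w = n then logCoeff k w.length else 0 := by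
    rw [hF]
    dsimp only
    rw [MonoidAlgebra.coeff_smul_apply, coeff_stuffleList_of k hne, hprod, coeff_word, if_pos rfl,
      hlen, smul_eq_mul, mul_one, mul_ite, mul_one, mul_zero]
    refine if_congr ⟨?_, fun h => ⟨FreeMonoid.toList w, rfl, h⟩⟩ rfl rfl
    rintro ⟨l, h4, h5⟩
    rwa [weight, List.map_injective_iff.mpr FreeMonoid.of_injective h4]
  rw [pi1, MonoidAlgebra.coeff_add, Finsupp.add_apply, h1, h2, coeff_word]
  have hmem : us₀ ∈ S ↔ 2 ≤ w.length := by rw [← hlen]; exact and_iff_left hne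
  rw [if_congr hmem rfl rfl, h3]
  -- The sum in `pi1` starts at `r = 2`; the separate term `word k w` of its definition supplies the
  -- words of length `1`.
  rcases Nat.lt_or_ge w.length 2 with h | h
  · rw [if_neg h.not_ge, add_zero]
    interval_cases hl : w.length
    · rw [FreeMonoid.length_eq_zero.mp hl, if_neg (FreeMonoid.of_ne_one n), if_neg]
      exact n.ne_zero.symm
    · obtain ⟨m, rfl⟩ := FreeMonoid.length_eq_one.mp hl
      rw [logCoeff_one]
      refine if_congr ?_ rfl rfl
      simp [weight, FreeMonoid.of_injective.eq_iff, eq_comm]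
  · rw [if_pos h, if_neg, zero_add]
    rintro rfl
    simp at h

end LetterCoefficients

end NCPoly

end

theorem mainTheorem5 (k : Type*) [CommRing k] [Algebra ℚ k] :
    (∀ n : ℕ+, PowerSeries.coeff (n : ℕ) (NCPoly.logSeries (NCPoly.genSeries k)) =
        NCPoly.pi1 k (FreeMonoid.of n)) ∧
      LieSubalgebra.lieSpan k (NCPoly k)
          {P | ∃ n : ℕ, 1 ≤ n ∧
            P = PowerSeries.coeff n (NCPoly.logSeries (NCPoly.genSeries k))} =
        NCPoly.prim k := by
  refine ⟨fun n => ?_, le_antisymm (NCPoly.logLie_le_prim k) (NCPoly.prim_le_logLie k)⟩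
  ext w
  rw [NCPoly.coeff_coeff_logSeries, NCPoly.coeff_pi1_of]
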